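/- **Theorem 3.** Let $n\in\mathbb N$, $r>0$, and let $f:C^0([-r,0];\mathbb R^n)\to\mathbb R^n$ satisfy $f(0)=0$ and be Lipschitz on bounded sets, i.e. there is a non-decreasing $L:[0,\infty)\to[0,\infty)$ with $|f(x)-f(y)|\le L(R)\|x-y\|_\infty$ for all $R\ge 0$ and all $x,y$ with $\|x\|_\infty,\|y\|_\infty\le R$. Consider the delay system $$\dot x(t)=f(x_t),\qquad x_t(s)=x(t+s)\ \ (s\in[-r,0]),\tag{1}$$ and let $\phi(t,x_0)=x_t$ denote the state at time $t\ge 0$ of the solution with initial condition $x_0\in C^0([-r,0];\mathbb R^n)$. Let $p\in(1,+\infty]$ (with $1/\infty=0$), and let $X$ be either the Sobolev space $W^{1,p}([-r,0])$ of absolutely continuous functions $x:[-r,0]\to\mathbb R^n$ with $\dot x\in L^p((-r,0);\mathbb R^n)$, with norm $\|x\|_X=\|x\|_\infty+\|\dot x\|_p$, or the Hölder space $C^{0,1-1/p}([-r,0])$ of functions $x:[-r,0]\to\mathbb R^n$ for which the norm $$\|x\|_X=\max\Big(\|x\|_\infty,\ \sup_{t\neq s}\frac{|x(t)-x(s)|}{|t-s|^{1-1/p}}\Big)$$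 is finite. Suppose that for every $x_0\in C^{0,1-1/p}([-r,0])$ the solution of (1) with initial condition $x_0$ exists for all $t\ge 0$. Then the following two properties are equivalent. * (GAS-X): for every $\varepsilon>0$ there is $\delta>0$ such that for all $x_0\in X$ with $\|x_0\|_X\le\delta$ the solution exists for all $t\ge0$ and $\|\phi(t,x_0)\|_X\le\varepsilon$ for all $t\ge 0$; and for every $x_0\in X$ the solution exists for all $t\ge 0$ and $\lim_{t\to+\infty}\|\phi(t,x_0)\|_X=0$. * (UGAS-X): there is a function $\sigma:[0,\infty)\times[0,\infty)\to[0,\infty)$ of class $KL$ (that is, for each $t\ge 0$ the map $\sigma(\cdot,t)$ is continuous and strictly increasing with $\sigma(0,t)=0$, and for each $s\ge 0$ the map $\sigma(s,\cdot)$ is non-increasing with $\lim_{t\to+\infty}\sigma(s,t)=0$) such that for every $x_0\in X$ the solution exists for all $t\ge0$ and $\|\phi(t,x_0)\|_X\le\sigma(\|x_0\|_X,t)$ for all $t\ge0$. -/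

import Mathlib

open scoped NNReal ENNReal Topology

noncomputable section

namespace DelaySystem

/-- `ℝⁿ` with its Euclidean norm. -/
abbrev Vec (n : ℕ) : Type := EuclideanSpace ℝ (Fin n)

/-- `C⁰([-r,0]; ℝⁿ)`. For `0 ≤ r` its Mathlib norm is the maximum norm `‖x‖_∞`. -/
abbrev History (n : ℕ) (r : ℝ) : Type := C(Set.Icc (-r) (0 : ℝ), Vec n)

variable {n : ℕ} {r : ℝ}

/-- The segment `x_t ∈ C⁰([-r,0]; ℝⁿ)`, `x_t(s) = x(t+s)`, of a trajectory `x`. -/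
def historyAt (r : ℝ) (x : C(ℝ, Vec n)) (t : ℝ) : History n r where
  toFun s := x (t + s)
  continuous_toFun := by fun_prop

/-- `f` is Lipschitz on bounded sets of `C⁰([-r,0]; ℝⁿ)`. -/
def LipschitzOnBounded (f : History n r → Vec n) : Prop :=
  ∃ L : ℝ≥0 → ℝ≥0, Monotone L ∧
    ∀ (R : ℝ≥0) (x y : History n r), ‖x‖ ≤ R → ‖y‖ ≤ R → ‖f x - f y‖ ≤ L R * ‖x - y‖

/-- `x` is a solution of `ẋ(t) = f(x_t)` on the whole of `[0,∞)` with initial condition `x₀`.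
At `t = 0` the derivative is the right derivative. A trajectory is a continuous function on
`[-r,∞)`, represented by any continuous extension to `ℝ`; the values before `-r` play no role. -/
def IsSolution (f : History n r → Vec n) (x₀ : History n r) (x : C(ℝ, Vec n)) : Prop :=
  historyAt r x 0 = x₀ ∧
    ∀ t : ℝ, 0 ≤ t → HasDerivWithinAt x (f (historyAt r x t)) (Set.Ici 0) t

open Classical in
/-- The norm `‖x‖_∞ + ‖ẋ‖_p` of `W^{1,p}([-r,0])`, extended by `∞` to all of `C⁰([-r,0]; ℝⁿ)`:
it is finite exactly when `x` is absolutely continuous with `ẋ ∈ L^p((-r,0); ℝⁿ)`. -/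
def sobolevNorm (hr : 0 < r) (p : ℝ≥0∞) (x : History n r) : ℝ≥0∞ :=
  if AbsolutelyContinuousOnInterval (Set.IccExtend (neg_nonpos.mpr hr.le) x) (-r) 0 then
    ‖x‖ₑ + MeasureTheory.eLpNorm (deriv (Set.IccExtend (neg_nonpos.mpr hr.le) x)) p
      (MeasureTheory.volume.restrict (Set.Ioo (-r) 0))
  else ∞

/-- The norm `max (‖x‖_∞, sup_{t ≠ s} |x(t) - x(s)| / |t - s|^a)` of `C^{0,a}([-r,0])`, extended by
`∞` to all of `C⁰([-r,0]; ℝⁿ)`: it is finite exactly when `x` is Hölder of exponent `a`. -/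
def hoelderNorm (a : ℝ) (x : History n r) : ℝ≥0∞ :=
  max ‖x‖ₑ (⨆ (t : Set.Icc (-r) (0 : ℝ)) (s : Set.Icc (-r) (0 : ℝ)) (_ : t ≠ s),
    ENNReal.ofReal (‖x t - x s‖ / |(t : ℝ) - (s : ℝ)| ^ a))

/-! In the stability notions below, `N` is an extended norm on `C⁰([-r,0]; ℝⁿ)` and the state space
is `X = {x | N x < ∞}`. Each notion contains the existence of the solution for all `t ≥ 0`. -/

/-- (LS-X) Lyapunov stability. -/
def LyapunovStable (N : History n r → ℝ≥0∞) (f : History n r → Vec n) : Prop :=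
  ∀ ε : ℝ≥0, 0 < ε → ∃ δ : ℝ≥0, 0 < δ ∧ ∀ x₀ : History n r, N x₀ ≤ δ →
    ∃ x : C(ℝ, Vec n), IsSolution f x₀ x ∧ ∀ t : ℝ≥0, N (historyAt r x t) ≤ ε

/-- (GA-X) Global attractivity. -/
def GloballyAttractive (N : History n r → ℝ≥0∞) (f : History n r → Vec n) : Prop :=
  ∀ x₀ : History n r, N x₀ < ∞ →
    ∃ x : C(ℝ, Vec n), IsSolution f x₀ x ∧
      Filter.Tendsto (fun t : ℝ≥0 => N (historyAt r x t)) Filter.atTop (𝓝 0)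

/-- (GAS-X) Global asymptotic stability. -/
def GAS (N : History n r → ℝ≥0∞) (f : History n r → Vec n) : Prop :=
  LyapunovStable N f ∧ GloballyAttractive N f

/-- Comparison functions of class `K`. -/
def ClassK (ρ : ℝ≥0 → ℝ≥0) : Prop :=
  StrictMono ρ ∧ Continuous ρ ∧ ρ 0 = 0

/-- Comparison functions of class `KL`. -/
def ClassKL (σ : ℝ≥0 → ℝ≥0 → ℝ≥0) : Prop :=
  (∀ t : ℝ≥0, ClassK fun s => σ s t) ∧
    ∀ s : ℝ≥0, Antitone (σ s) ∧ Filter.Tendsto (σ s) Filter.atTop (𝓝 0)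

/-- (UGAS-X) Uniform global asymptotic stability. -/
def UGAS (N : History n r → ℝ≥0∞) (f : History n r → Vec n) : Prop :=
  ∃ σ : ℝ≥0 → ℝ≥0 → ℝ≥0, ClassKL σ ∧ ∀ x₀ : History n r, N x₀ < ∞ →
    ∃ x : C(ℝ, Vec n), IsSolution f x₀ x ∧
      ∀ t : ℝ≥0, N (historyAt r x t) ≤ σ (N x₀).toNNReal t

end DelaySystem

end

namespace DelaySystem

variable {n : ℕ} {r : ℝ}

/-! ### Hölder norm -/

/-! Uniformity comes from compactness. Since `1 < p`, the exponent `a = 1 - 1/p` is positive, and a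
bounded set of either space lies in a ball of `C^{0,a}`, which is compact in `C⁰` by Arzelà–Ascoli
(`isCompact_hoelder_ball`). Gronwall gives continuous dependence in the supremum norm, and the delay
equation smooths: after one delay the state is Lipschitz, so its norm in `X` is controlled by a
supremum bound on the trajectory.

Attractivity brings each trajectory near zero, hence all neighbouring ones too at one common time;
smoothing turns this into smallness in `X`, and Lyapunov stability keeps it for all later times. A
finite subcover yields one attraction time per ball (`exists_uniform_attraction_time`). The same
argument bounds trajectories on compact time intervals, which gives uniform boundedness in `X`
(`exists_uniform_stateNorm_bound`). The supremum of the norm over a ball and over all later times is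
then finite, monotone and decaying, so it has a `KL` majorant (`exists_classKL_ge`). The converse is
read off from `σ`. Both spaces are treated at once through `IsStateNorm`. -/

theorem hoelderNorm_le_iff {a : ℝ} (x : History n r) (R : ℝ≥0) :
    hoelderNorm a x ≤ R ↔ ‖x‖ ≤ R ∧
      ∀ t s : Set.Icc (-r) (0 : ℝ), ‖x t - x s‖ ≤ R * |(t : ℝ) - s| ^ a := by
  have h1 : ‖x‖ₑ ≤ (R : ℝ≥0∞) ↔ ‖x‖ ≤ R := by
    rw [enorm_eq_nnnorm, ENNReal.coe_le_coe, ← NNReal.coe_le_coe, coe_nnnorm]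
  rw [hoelderNorm, max_le_iff, h1]
  refine and_congr_right fun _ => ?_
  simp only [iSup_le_iff]
  refine forall_congr' fun t => forall_congr' fun s => ?_
  by_cases hts : t = s
  · subst hts
    simp only [ne_eq, not_true_eq_false, false_imp_iff, sub_self, norm_zero, true_iff]
    positivity
  · have hpos : 0 < |(t : ℝ) - s| ^ a :=
      Real.rpow_pos_of_pos (abs_pos.2 (sub_ne_zero.2 fun h => hts (Subtype.ext h))) _
    simp only [ne_eq, hts, not_false_eq_true, forall_true_left]
    rw [← ENNReal.ofReal_coe_nnreal, ENNReal.ofReal_le_ofReal_iff R.coe_nonneg, div_le_iff₀ hpos]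

theorem isCompact_hoelder_ball {a : ℝ} (ha : 0 < a) (R : ℝ≥0) :
    IsCompact {x : History n r | hoelderNorm a x ≤ R} := by
  simp only [hoelderNorm_le_iff]
  have hb : Filter.Tendsto (fun d : ℝ => (R : ℝ) * d ^ a) (𝓝 0) (𝓝 0) := by
    have h : Continuous fun d : ℝ => (R : ℝ) * d ^ a :=
      continuous_const.mul (Real.continuous_rpow_const ha.le)
    simpa [Real.zero_rpow ha.ne'] using h.tendsto 0
  refine ArzelaAscoli.isCompact_of_equicontinuous _ ?_ ?_
  -- In the product topology the set is closed in a product of closed balls; no limit points are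
  -- lost, because the Hölder bound itself forces continuity.
  · have hK : IsCompact {g : Set.Icc (-r) (0 : ℝ) → Vec n | (∀ t, ‖g t‖ ≤ R) ∧
        ∀ t s : Set.Icc (-r) (0 : ℝ), ‖g t - g s‖ ≤ R * |(t : ℝ) - s| ^ a} := by
      refine IsCompact.of_isClosed_subset
        (isCompact_univ_pi fun _ => isCompact_closedBall (0 : Vec n) (R : ℝ)) ?_ ?_
      · simp only [Set.ofPred_and, Set.ofPred_forall]
        refine (isClosed_iInter fun t => ?_).inter
          (isClosed_iInter fun t => isClosed_iInter fun s => ?_)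
        · exact isClosed_le (by fun_prop) continuous_const
        · exact isClosed_le (by fun_prop) continuous_const
      · intro g hg t _
        simpa using hg.1 t
    convert hK using 1
    ext g
    constructor
    · rintro ⟨x, hx, rfl⟩
      exact ⟨fun t => (x.norm_coe_le_norm t).trans hx.1, hx.2⟩
    · rintro ⟨h1, h2⟩
      have hc : Continuous g := by
        refine continuous_iff_continuousAt.2 fun t => ?_
        rw [ContinuousAt, tendsto_iff_dist_tendsto_zero]
        have h3 : Filter.Tendsto (fun s : Set.Icc (-r) (0 : ℝ) => |(s : ℝ) - t|) (𝓝 t) (𝓝 0) := by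
          have : Continuous fun s : Set.Icc (-r) (0 : ℝ) => |(s : ℝ) - t| := by fun_prop
          simpa using this.tendsto t
        exact squeeze_zero (fun _ => dist_nonneg)
          (fun s => by rw [dist_eq_norm]; exact h2 s t) (hb.comp h3)
      exact ⟨⟨g, hc⟩, ⟨(ContinuousMap.norm_le _ R.coe_nonneg).2 h1, h2⟩, rfl⟩
  · refine Metric.equicontinuous_of_continuity_modulus _ hb _ fun t s x => ?_
    rw [dist_eq_norm, Subtype.dist_eq, Real.dist_eq]
    exact x.2.2 t s

/-! ### State norms -/

/-- The history `s ↦ y(min(t+s,0))`: shift `y` to the left by `t` and extend by the constant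
`y(0)`. -/
def holdShift (hr : 0 ≤ r) (t : ℝ≥0) (y : History n r) : History n r where
  toFun s := y ⟨min (t + s) 0, le_min (by linarith [s.2.1, t.coe_nonneg]) (by linarith),
    min_le_right _ _⟩
  continuous_toFun := by fun_prop

/-- The properties of an extended norm on `C⁰([-r,0]; ℝⁿ)` that make asymptotic stability in it
uniform: it dominates a Hölder norm, is subadditive, does not grow under `holdShift`, and is
controlled by the Lipschitz constant. -/
structure IsStateNorm (hr : 0 ≤ r) (a : ℝ) (N : History n r → ℝ≥0∞) : Prop where
  hoelder_le : ∀ x, hoelderNorm a x ≤ N x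
  add_le : ∀ x y, N (x + y) ≤ N x + N y
  holdShift_le : ∀ t y, N (holdShift hr t y) ≤ N y
  lipschitz_le : ∃ C : ℝ≥0, ∀ (D : ℝ≥0) (y : History n r), LipschitzWith D y →
    N y ≤ ‖y‖ₑ + C * D

theorem le_of_forall_nnreal_le {b c : ℝ≥0∞} (h : ∀ R : ℝ≥0, c ≤ R → b ≤ R) : b ≤ c := by
  induction c with
  | top => exact le_top
  | coe c => exact h c le_rfl

theorem isStateNorm_hoelderNorm (hr : 0 ≤ r) {a : ℝ} (ha : 0 < a) (ha1 : a ≤ 1) :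
    IsStateNorm hr a (hoelderNorm (n := n) (r := r) a) where
  hoelder_le x := le_rfl
  add_le x y := by
    generalize hb : hoelderNorm a x = b
    generalize hc : hoelderNorm a y = c
    induction b with
    | top => simp
    | coe b =>
      induction c with
      | top => simp
      | coe c =>
        have h1 := (hoelderNorm_le_iff x b).1 hb.le
        have h2 := (hoelderNorm_le_iff y c).1 hc.le
        rw [← ENNReal.coe_add, hoelderNorm_le_iff]
        refine ⟨(norm_add_le _ _).trans (by push_cast; exact add_le_add h1.1 h2.1), fun t s => ?_⟩
        calc ‖(x + y) t - (x + y) s‖ = ‖(x t - x s) + (y t - y s)‖ := by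
              rw [ContinuousMap.add_apply, ContinuousMap.add_apply, add_sub_add_comm]
          _ ≤ b * |(t : ℝ) - s| ^ a + c * |(t : ℝ) - s| ^ a :=
              (norm_add_le _ _).trans (add_le_add (h1.2 t s) (h2.2 t s))
          _ = _ := by push_cast; ring
  holdShift_le t y := by
    refine le_of_forall_nnreal_le fun R hR => ?_
    rw [hoelderNorm_le_iff] at hR ⊢
    refine ⟨(ContinuousMap.norm_le _ R.coe_nonneg).2 fun s => (y.norm_coe_le_norm _).trans hR.1,
      fun u s => (hR.2 _ _).trans ?_⟩
    refine mul_le_mul_of_nonneg_left (Real.rpow_le_rpow (abs_nonneg _) ?_ ha.le) R.coe_nonneg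
    change |min ((t : ℝ) + u) 0 - min ((t : ℝ) + s) 0| ≤ _
    refine (abs_min_sub_min_le_max _ _ _ _).trans_eq ?_
    rw [add_sub_add_left_eq_sub, sub_zero, abs_zero, max_eq_left (abs_nonneg _)]
  lipschitz_le := by
    -- The constant comes from `|t - s| = |t - s|^(1-a) |t - s|^a` and `|t - s| ≤ r`.
    have hC : ((r ^ (1 - a)).toNNReal : ℝ) = r ^ (1 - a) := Real.coe_toNNReal _ (by positivity)
    refine ⟨(r ^ (1 - a)).toNNReal, fun D y hy => ?_⟩
    rw [enorm_eq_nnnorm, ← ENNReal.coe_mul, ← ENNReal.coe_add, hoelderNorm_le_iff]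
    have h0 : (0 : ℝ) ≤ r ^ (1 - a) * D := by positivity
    push_cast
    rw [hC]
    constructor
    · simpa using h0
    · intro t s
      have h1 : ‖y t - y s‖ ≤ D * |(t : ℝ) - s| := by
        simpa [dist_eq_norm, Subtype.dist_eq, Real.dist_eq] using hy.dist_le_mul t s
      have h2 : |(t : ℝ) - s| ≤ r := by
        rw [abs_le]; constructor <;> linarith [t.2.1, t.2.2, s.2.1, s.2.2]
      have h3 : |(t : ℝ) - s| = |(t : ℝ) - s| ^ (1 - a) * |(t : ℝ) - s| ^ a := by
        rw [← Real.rpow_add_of_nonneg (abs_nonneg _) (by linarith) ha.le]; simp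
      have h4 : |(t : ℝ) - s| ^ (1 - a) ≤ r ^ (1 - a) :=
        Real.rpow_le_rpow (abs_nonneg _) h2 (by linarith)
      have h5 : 0 ≤ |(t : ℝ) - s| ^ a := by positivity
      calc ‖y t - y s‖ ≤ D * |(t : ℝ) - s| := h1
        _ = D * |(t : ℝ) - s| ^ (1 - a) * |(t : ℝ) - s| ^ a := by rw [mul_assoc, ← h3]
        _ ≤ D * r ^ (1 - a) * |(t : ℝ) - s| ^ a := by gcongr
        _ ≤ (‖y‖ + r ^ (1 - a) * D) * |(t : ℝ) - s| ^ a := by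
            gcongr; linarith [norm_nonneg y]

/-! ### Absolutely continuous functions -/

/-- A monotone map sends disjoint intervals to disjoint intervals, and a 1-Lipschitz map does not
increase their total length. -/
theorem _root_.AbsolutelyContinuousOnInterval.comp_monotone {X : Type*} [PseudoMetricSpace X]
    {g : ℝ → X} {h : ℝ → ℝ} {a b c d : ℝ} (hg : AbsolutelyContinuousOnInterval g c d)
    (hm : Monotone h) (hl : LipschitzWith 1 h)
    (hmap : Set.MapsTo h (Set.uIcc a b) (Set.uIcc c d)) :
    AbsolutelyContinuousOnInterval (g ∘ h) a b := by
  rw [absolutelyContinuousOnInterval_iff] at hg ⊢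
  intro ε hε
  obtain ⟨δ, hδ, H⟩ := hg ε hε
  refine ⟨δ, hδ, fun E hE hlen => ?_⟩
  refine H (E.1, fun i => (h (E.2 i).1, h (E.2 i).2)) ⟨fun i hi => ?_, ?_⟩ ?_
  · exact ⟨hmap (hE.1 i hi).1, hmap (hE.1 i hi).2⟩
  · intro i hi j hj hij
    have hdis := hE.2 hi hj hij
    simp only [Function.onFun, Set.disjoint_left, ← hm.map_min, ← hm.map_max,
      Set.uIoc, Set.mem_Ioc] at hdis ⊢
    rintro y ⟨h1, h2⟩ ⟨h3, h4⟩
    -- A common point of the two images would give `h z < h w`, hence `z < w`, and then `w` lies in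
    -- both original intervals.
    set z := max (min (E.2 i).1 (E.2 i).2) (min (E.2 j).1 (E.2 j).2) with hz
    set w := min (max (E.2 i).1 (E.2 i).2) (max (E.2 j).1 (E.2 j).2) with hw
    have hzy : h z < y := by rw [hz, hm.map_max]; exact max_lt h1 h3
    have hyw : y ≤ h w := by rw [hw, hm.map_min]; exact le_min h2 h4
    have hzw : z < w := hm.reflect_lt (hzy.trans_le hyw)
    exact hdis ⟨(le_max_left _ _).trans_lt hzw, min_le_left _ _⟩
      ⟨(le_max_right _ _).trans_lt hzw, min_le_right _ _⟩
  · refine lt_of_le_of_lt (Finset.sum_le_sum fun i _ => ?_) hlen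
    simpa using hl.dist_le_mul (E.2 i).1 (E.2 i).2

theorem _root_.LipschitzWith.comp_absolutelyContinuousOnInterval {X Y : Type*}
    [PseudoMetricSpace X] [PseudoMetricSpace Y] {K : ℝ≥0} {φ : X → Y} (hφ : LipschitzWith K φ)
    {g : ℝ → X} {a b : ℝ} (hg : AbsolutelyContinuousOnInterval g a b) :
    AbsolutelyContinuousOnInterval (φ ∘ g) a b := by
  refine squeeze_zero (fun E => Finset.sum_nonneg fun _ _ => dist_nonneg) (fun E => ?_)
    (by simpa using Filter.Tendsto.const_mul (K : ℝ) hg)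
  rw [Finset.mul_sum]
  exact Finset.sum_le_sum fun i _ => hφ.dist_le_mul _ _

open MeasureTheory in
-- The scalar fundamental theorem of calculus applies to `⟨u, g⟩` with `u = g b - g a`;
-- Cauchy–Schwarz bounds its derivative, and one factor `‖u‖` cancels.
theorem enorm_sub_le_lintegral_deriv {g : ℝ → Vec n} {a b : ℝ} (hab : a ≤ b)
    (hg : AbsolutelyContinuousOnInterval g a b) :
    ‖g b - g a‖ₑ ≤ ∫⁻ s in Set.Ioc a b, ‖deriv g s‖ₑ := by
  set u : Vec n := g b - g a with hu
  by_cases hu0 : ‖u‖ₑ = 0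
  · simp [hu0]
  have hac : AbsolutelyContinuousOnInterval (fun s => inner ℝ u (g s)) a b :=
    (innerSL ℝ u).lipschitz.comp_absolutelyContinuousOnInterval hg
  have h1 := hac.integral_deriv_eq_sub
  rw [← inner_sub_right, ← hu, real_inner_self_eq_norm_sq, intervalIntegral.integral_of_le hab] at h1
  have hd : ∀ᵐ s ∂volume.restrict (Set.Ioc a b),
      ‖deriv (fun s => inner ℝ u (g s)) s‖ₑ ≤ ‖u‖ₑ * ‖deriv g s‖ₑ := by
    rw [ae_restrict_iff' measurableSet_Ioc]
    filter_upwards [hg.boundedVariationOn.ae_differentiableAt_of_mem_uIcc] with s hs hsab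
    have hsd := hs (by rw [Set.uIcc_of_le hab]; exact Set.Ioc_subset_Icc_self hsab)
    have : deriv (fun s => inner ℝ u (g s)) s = inner ℝ u (deriv g s) :=
      (((innerSL ℝ u).hasFDerivAt (x := g s)).comp_hasDerivAt s hsd.hasDerivAt).deriv
    rw [this]
    simp only [enorm_eq_nnnorm, ← ENNReal.coe_mul, ENNReal.coe_le_coe]
    exact nnnorm_inner_le_nnnorm u _
  have h2 : ‖u‖ₑ * ‖u‖ₑ ≤ ‖u‖ₑ * ∫⁻ s in Set.Ioc a b, ‖deriv g s‖ₑ := by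
    calc ‖u‖ₑ * ‖u‖ₑ = ‖‖u‖ ^ 2‖ₑ := by rw [enorm_pow, enorm_norm, sq]
      _ ≤ ∫⁻ s in Set.Ioc a b, ‖deriv (fun s => inner ℝ u (g s)) s‖ₑ := by
          rw [← h1]; exact enorm_integral_le_lintegral_enorm _
      _ ≤ ∫⁻ s in Set.Ioc a b, ‖u‖ₑ * ‖deriv g s‖ₑ := lintegral_mono_ae hd
      _ = _ := lintegral_const_mul' _ _ enorm_ne_top
  exact (ENNReal.mul_le_mul_iff_right hu0 enorm_ne_top).1 h2

open MeasureTheory in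
theorem enorm_sub_le_eLpNorm_deriv {g : ℝ → Vec n} {a b : ℝ} (hab : a ≤ b)
    (hg : AbsolutelyContinuousOnInterval g a b) {p : ℝ≥0∞} (hp : 1 ≤ p) :
    ‖g b - g a‖ₑ ≤ eLpNorm (deriv g) p (volume.restrict (Set.Ioo a b)) *
      ENNReal.ofReal (b - a) ^ (1 - p⁻¹).toReal := by
  refine (enorm_sub_le_lintegral_deriv hab hg).trans ?_
  rw [← eLpNorm_one_eq_lintegral_enorm, ← restrict_Ioo_eq_restrict_Ioc]
  refine (eLpNorm_le_eLpNorm_mul_rpow_measure_univ hp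
    (aestronglyMeasurable_deriv g _)).trans_eq ?_
  rw [Measure.restrict_apply_univ, Real.volume_Ioo, ENNReal.toReal_sub_of_le (by simpa) (by simp)]
  simp

/-! ### Sobolev norm -/

open MeasureTheory

theorem sobolevNorm_eq (hr : 0 < r) (p : ℝ≥0∞) {x : History n r}
    (hx : AbsolutelyContinuousOnInterval (Set.IccExtend (neg_nonpos.mpr hr.le) x) (-r) 0) :
    sobolevNorm hr p x = ‖x‖ₑ + eLpNorm (deriv (Set.IccExtend (neg_nonpos.mpr hr.le) x)) p
      (volume.restrict (Set.Ioo (-r) 0)) :=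
  if_pos hx

theorem sobolevNorm_eq_top (hr : 0 < r) (p : ℝ≥0∞) {x : History n r}
    (hx : ¬AbsolutelyContinuousOnInterval (Set.IccExtend (neg_nonpos.mpr hr.le) x) (-r) 0) :
    sobolevNorm hr p x = ∞ :=
  if_neg hx

theorem hoelderNorm_le_sobolevNorm (hr : 0 < r) {p : ℝ≥0∞} (hp : 1 ≤ p) (x : History n r) :
    hoelderNorm (1 - p⁻¹).toReal x ≤ sobolevNorm hr p x := by
  by_cases hx : AbsolutelyContinuousOnInterval (Set.IccExtend (neg_nonpos.mpr hr.le) x) (-r) 0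
  swap
  · rw [sobolevNorm_eq_top hr p hx]; exact le_top
  refine le_of_forall_nnreal_le fun R hR => ?_
  rw [sobolevNorm_eq hr p hx] at hR
  rw [hoelderNorm_le_iff]
  constructor
  · have h := le_self_add.trans hR
    rwa [enorm_eq_nnnorm, ENNReal.coe_le_coe, ← NNReal.coe_le_coe, coe_nnnorm] at h
  · have key : ∀ t s : Set.Icc (-r) (0 : ℝ), (s : ℝ) ≤ t →
        ‖x t - x s‖ ≤ R * |(t : ℝ) - s| ^ (1 - p⁻¹).toReal := by
      intro t s hst
      have hac := hx.mono (c := s) (d := t) (by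
        rw [Set.uIcc_of_le hst, Set.uIcc_of_le (by linarith)]
        exact Set.Icc_subset_Icc s.2.1 t.2.2)
      have h1 := enorm_sub_le_eLpNorm_deriv hst hac hp
      rw [Set.IccExtend_val, Set.IccExtend_val] at h1
      have h2 : eLpNorm (deriv (Set.IccExtend (neg_nonpos.mpr hr.le) x)) p
          (volume.restrict (Set.Ioo (s : ℝ) t)) ≤ R :=
        (eLpNorm_mono_measure _ (Measure.restrict_mono
          (Set.Ioo_subset_Ioo s.2.1 t.2.2) le_rfl)).trans (le_add_self.trans hR)
      have h3 : ‖x t - x s‖ₑ ≤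
          ENNReal.ofReal (R * |(t : ℝ) - s| ^ (1 - p⁻¹).toReal) := by
        rw [ENNReal.ofReal_mul R.coe_nonneg, ENNReal.ofReal_coe_nnreal,
          abs_of_nonneg (sub_nonneg.2 hst),
          ← ENNReal.ofReal_rpow_of_nonneg (sub_nonneg.2 hst) ENNReal.toReal_nonneg]
        exact h1.trans (by gcongr)
      rw [← ofReal_norm] at h3
      exact (ENNReal.ofReal_le_ofReal_iff (by positivity)).1 h3
    intro t s
    rcases le_total (s : ℝ) t with h | h
    · exact key t s h
    · rw [norm_sub_rev, abs_sub_comm]; exact key s t h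

theorem iccExtend_holdShift (hr : 0 < r) (t : ℝ≥0) (y : History n r) :
    Set.IccExtend (neg_nonpos.mpr hr.le) (holdShift hr.le t y) =
      Set.IccExtend (neg_nonpos.mpr hr.le) y ∘
        fun s => min ((t : ℝ) + Set.projIcc (-r) 0 (neg_nonpos.mpr hr.le) s) 0 := by
  funext s
  have hmem : min ((t : ℝ) + Set.projIcc (-r) 0 (neg_nonpos.mpr hr.le) s) 0 ∈ Set.Icc (-r) 0 :=
    ⟨le_min (by linarith [(Set.projIcc (-r) 0 (neg_nonpos.mpr hr.le) s).2.1, t.coe_nonneg])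
      (by linarith), min_le_right _ _⟩
  rw [Function.comp_apply, Set.IccExtend_of_mem _ y hmem]
  rfl

/-- Away from the kink at `-t`, the derivative is a translate of that of `y` on the left and zero on
the right. Translation invariance leaves the norm over `(t - r, 0)`, a subset of `(-r, 0)`. -/
theorem eLpNorm_deriv_holdShift_le (hr : 0 < r) (p : ℝ≥0∞) (t : ℝ≥0) (y : History n r) :
    eLpNorm (deriv (Set.IccExtend (neg_nonpos.mpr hr.le) (holdShift hr.le t y))) p
        (volume.restrict (Set.Ioo (-r) 0)) ≤
      eLpNorm (deriv (Set.IccExtend (neg_nonpos.mpr hr.le) y)) p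
        (volume.restrict (Set.Ioo (-r) 0)) := by
  set Y := Set.IccExtend (neg_nonpos.mpr hr.le) y with hY
  set Z := Set.IccExtend (neg_nonpos.mpr hr.le) (holdShift hr.le t y) with hZ
  have hval : ∀ s ∈ Set.Ioo (-r) 0, Z s = Y (min ((t : ℝ) + s) 0) := by
    intro s hs
    rw [hZ, iccExtend_holdShift hr, Function.comp_apply,
      Set.projIcc_of_mem _ (Set.Ioo_subset_Icc_self hs)]
  have hae : deriv Z =ᵐ[volume.restrict (Set.Ioo (-r) 0)]
      (Set.Iio (-(t : ℝ))).indicator (fun s => deriv Y (t + s)) := by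
    rw [Filter.EventuallyEq, ae_restrict_iff' measurableSet_Ioo]
    have hne : ∀ᵐ s : ℝ, s ≠ -(t : ℝ) := by simp [ae_iff, measure_singleton]
    filter_upwards [hne] with s hs hsI
    rcases lt_or_gt_of_ne hs with h | h
    · rw [Set.indicator_of_mem (by exact h)]
      have : Z =ᶠ[𝓝 s] fun s => Y (t + s) := by
        filter_upwards [isOpen_Ioo.mem_nhds hsI, isOpen_Iio.mem_nhds h] with u hu hu'
        rw [hval u hu, min_eq_left]
        have : u < -(t : ℝ) := hu'
        linarith
      rw [this.deriv_eq, deriv_comp_const_add]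
    · rw [Set.indicator_of_notMem (by simpa using h.le)]
      have : Z =ᶠ[𝓝 s] fun _ => Y 0 := by
        filter_upwards [isOpen_Ioo.mem_nhds hsI, isOpen_Ioi.mem_nhds h] with u hu hu'
        rw [hval u hu, min_eq_right]
        have : -(t : ℝ) < u := hu'
        linarith
      rw [this.deriv_eq, deriv_const]
  rw [eLpNorm_congr_ae hae, eLpNorm_indicator_eq_eLpNorm_restrict measurableSet_Iio,
    Measure.restrict_restrict measurableSet_Iio]
  have hmp : MeasurePreserving (fun s : ℝ => (t : ℝ) + s)
      (volume.restrict ((fun s : ℝ => (t : ℝ) + s) ⁻¹' Set.Ioo (t - r) 0))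
      (volume.restrict (Set.Ioo ((t : ℝ) - r) 0)) :=
    (measurePreserving_add_left volume (t : ℝ)).restrict_preimage measurableSet_Ioo
  have hset : (fun s : ℝ => (t : ℝ) + s) ⁻¹' Set.Ioo (t - r) 0 =
      Set.Iio (-(t : ℝ)) ∩ Set.Ioo (-r) 0 := by
    ext s
    simp only [Set.mem_preimage, Set.mem_Ioo, Set.mem_inter_iff, Set.mem_Iio]
    have := t.coe_nonneg
    constructor
    · rintro ⟨h1, h2⟩; exact ⟨by linarith, by linarith, by linarith⟩
    · rintro ⟨h1, h2, h3⟩; exact ⟨by linarith, by linarith⟩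
  rw [hset] at hmp
  have := eLpNorm_comp_measurePreserving (p := p) (aestronglyMeasurable_deriv Y _) hmp
  rw [Function.comp_def] at this
  rw [this]
  exact eLpNorm_mono_measure _ (Measure.restrict_mono
    (Set.Ioo_subset_Ioo (by linarith [t.coe_nonneg]) le_rfl) le_rfl)

theorem isStateNorm_sobolevNorm (hr : 0 < r) {p : ℝ≥0∞} (hp : 1 ≤ p) :
    IsStateNorm hr.le (1 - p⁻¹).toReal (sobolevNorm (n := n) hr p) where
  hoelder_le := hoelderNorm_le_sobolevNorm hr hp
  add_le x y := by
    by_cases hx : AbsolutelyContinuousOnInterval (Set.IccExtend (neg_nonpos.mpr hr.le) x) (-r) 0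
    swap
    · simp [sobolevNorm_eq_top hr p hx]
    by_cases hy : AbsolutelyContinuousOnInterval (Set.IccExtend (neg_nonpos.mpr hr.le) y) (-r) 0
    swap
    · simp [sobolevNorm_eq_top hr p hy]
    have hadd : Set.IccExtend (neg_nonpos.mpr hr.le) (x + y) =
        Set.IccExtend (neg_nonpos.mpr hr.le) x + Set.IccExtend (neg_nonpos.mpr hr.le) y := rfl
    have hxy : AbsolutelyContinuousOnInterval
        (Set.IccExtend (neg_nonpos.mpr hr.le) (x + y)) (-r) 0 := by
      rw [hadd]; exact hx.add hy
    rw [sobolevNorm_eq hr p hx, sobolevNorm_eq hr p hy, sobolevNorm_eq hr p hxy, hadd,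
      add_add_add_comm]
    refine add_le_add (by
      simp only [enorm_eq_nnnorm]; exact_mod_cast nnnorm_add_le x y) ?_
    have hae : deriv (Set.IccExtend (neg_nonpos.mpr hr.le) x +
          Set.IccExtend (neg_nonpos.mpr hr.le) y) =ᵐ[volume.restrict (Set.Ioo (-r) 0)]
        deriv (Set.IccExtend (neg_nonpos.mpr hr.le) x) +
          deriv (Set.IccExtend (neg_nonpos.mpr hr.le) y) := by
      rw [Filter.EventuallyEq, ae_restrict_iff' measurableSet_Ioo]
      filter_upwards [hx.boundedVariationOn.ae_differentiableAt_of_mem_uIcc,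
        hy.boundedVariationOn.ae_differentiableAt_of_mem_uIcc] with s hs1 hs2 hs
      have hs' : s ∈ Set.uIcc (-r) 0 := by
        rw [Set.uIcc_of_le (by linarith)]; exact Set.Ioo_subset_Icc_self hs
      rw [deriv_add (hs1 hs') (hs2 hs'), Pi.add_apply]
    rw [eLpNorm_congr_ae hae]
    exact eLpNorm_add_le (aestronglyMeasurable_deriv _ _) (aestronglyMeasurable_deriv _ _) hp
  holdShift_le t y := by
    by_cases hy : AbsolutelyContinuousOnInterval (Set.IccExtend (neg_nonpos.mpr hr.le) y) (-r) 0
    swap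
    · rw [sobolevNorm_eq_top hr p hy]; exact le_top
    have hs : AbsolutelyContinuousOnInterval
        (Set.IccExtend (neg_nonpos.mpr hr.le) (holdShift hr.le t y)) (-r) 0 := by
      rw [iccExtend_holdShift hr]
      refine hy.comp_monotone ?_ ?_ ?_
      · intro u v huv
        exact min_le_min_right _ (add_le_add le_rfl (Set.monotone_projIcc _ huv))
      · refine LipschitzWith.of_dist_le_mul fun u v => ?_
        rw [Real.dist_eq, Real.dist_eq, NNReal.coe_one, one_mul]
        refine (abs_min_sub_min_le_max _ _ _ _).trans ?_
        rw [add_sub_add_left_eq_sub, sub_zero, abs_zero, max_eq_left (abs_nonneg _)]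
        simpa [Real.dist_eq, Subtype.dist_eq] using
          (LipschitzWith.projIcc (neg_nonpos.mpr hr.le)).dist_le_mul u v
      · intro s _
        rw [Set.uIcc_of_le (by linarith)]
        exact ⟨le_min (by linarith [(Set.projIcc (-r) 0 (neg_nonpos.mpr hr.le) s).2.1,
          t.coe_nonneg]) (by linarith), min_le_right _ _⟩
    rw [sobolevNorm_eq hr p hs, sobolevNorm_eq hr p hy]
    refine add_le_add ?_ (eLpNorm_deriv_holdShift_le hr p t y)
    rw [enorm_eq_nnnorm, enorm_eq_nnnorm, ENNReal.coe_le_coe, ← NNReal.coe_le_coe]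
    exact (ContinuousMap.norm_le _ (norm_nonneg y)).2 fun s => y.norm_coe_le_norm _
  lipschitz_le := by
    -- For `p = ∞` the conventions `∞.toReal = 0` and `0⁻¹ = 0` give the correct constant `1`.
    refine ⟨r.toNNReal ^ p.toReal⁻¹, fun D y hy => ?_⟩
    have hl : LipschitzWith D (Set.IccExtend (neg_nonpos.mpr hr.le) y) := by
      have := hy.comp (LipschitzWith.projIcc (neg_nonpos.mpr hr.le))
      rwa [mul_one] at this
    rw [sobolevNorm_eq hr p hl.lipschitzOnWith.absolutelyContinuousOnInterval]
    gcongr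
    refine (eLpNorm_le_of_ae_bound (C := D)
      (Filter.Eventually.of_forall fun s => norm_deriv_le_of_lipschitz hl)).trans_eq ?_
    rw [Measure.restrict_apply_univ, Real.volume_Ioo, ENNReal.ofReal_coe_nnreal, zero_sub, neg_neg,
      ENNReal.coe_rpow_of_nonneg _ (by positivity)]
    rfl

/-! ### Solutions -/

/-- The trajectory `t ↦ x(T + t)`. -/
def shift (x : C(ℝ, Vec n)) (T : ℝ) : C(ℝ, Vec n) where
  toFun t := x (T + t)
  continuous_toFun := by fun_prop

theorem historyAt_shift (x : C(ℝ, Vec n)) (T t : ℝ) :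
    historyAt r (shift x T) t = historyAt r x (T + t) := by
  ext1 s
  exact congrArg x (add_assoc T t s).symm

theorem IsSolution.shift {f : History n r → Vec n} {x₀ : History n r} {x : C(ℝ, Vec n)}
    (hx : IsSolution f x₀ x) {T : ℝ} (hT : 0 ≤ T) :
    IsSolution f (historyAt r x T) (shift x T) := by
  refine ⟨by rw [historyAt_shift, add_zero], fun t ht => ?_⟩
  rw [historyAt_shift]
  have h := (hx.2 (T + t) (by linarith)).scomp t (h := fun s => T + s) (s := Set.Ici 0) (h' := 1)
    ((hasDerivWithinAt_id t _).const_add T) fun s (hs : 0 ≤ s) => add_nonneg hT hs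
  rw [one_smul] at h
  exact h

theorem norm_historyAt_le {x : C(ℝ, Vec n)} {t M : ℝ} (hM : 0 ≤ M)
    (h : ∀ s ∈ Set.Icc (t - r) t, ‖x s‖ ≤ M) : ‖historyAt r x t‖ ≤ M :=
  (ContinuousMap.norm_le _ hM).2 fun s => h _ ⟨by linarith [s.2.1], by linarith [s.2.2]⟩

theorem norm_apply_le_norm_historyAt (x : C(ℝ, Vec n)) {t s : ℝ} (h : s ∈ Set.Icc (t - r) t) :
    ‖x s‖ ≤ ‖historyAt r x t‖ := by
  have := (historyAt r x t).norm_coe_le_norm ⟨s - t, by linarith [h.1], by linarith [h.2]⟩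
  change ‖x (t + (s - t))‖ ≤ _ at this
  rwa [add_sub_cancel] at this

theorem exists_norm_le_on_Icc (x : C(ℝ, Vec n)) (a b : ℝ) :
    ∃ M : ℝ≥0, ∀ s ∈ Set.Icc a b, ‖x s‖ ≤ M := by
  obtain ⟨C, hC⟩ := isCompact_Icc.exists_bound_of_continuousOn
    (x.continuous.continuousOn (s := Set.Icc a b))
  exact ⟨C.toNNReal, fun s hs => (hC s hs).trans (Real.le_coe_toNNReal C)⟩

theorem LipschitzOnBounded.exists_lipschitz_const {f : History n r → Vec n}
    (hf : LipschitzOnBounded f) (M : ℝ≥0) :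
    ∃ L : ℝ≥0, ∀ x y : History n r, ‖x‖ ≤ M → ‖y‖ ≤ M → ‖f x - f y‖ ≤ L * ‖x - y‖ := by
  obtain ⟨L, -, hL⟩ := hf
  exact ⟨L M, hL M⟩

/-- Gronwall estimate for solutions with nearby initial conditions, one of which is bounded. -/
theorem IsSolution.norm_sub_le (hr : 0 ≤ r) {f : History n r → Vec n} {x₀ y₀ : History n r}
    {x y : C(ℝ, Vec n)} (hx : IsSolution f x₀ x) (hy : IsSolution f y₀ y) {M L : ℝ≥0}
    (hL : ∀ u v : History n r, ‖u‖ ≤ M + 1 → ‖v‖ ≤ M + 1 → ‖f u - f v‖ ≤ L * ‖u - v‖)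
    {T ρ : ℝ} (hM : ∀ s ∈ Set.Icc (-r) T, ‖x s‖ ≤ M) (hT : 0 ≤ T) (hρ : 0 < ρ)
    (hρ1 : 2 * ρ * Real.exp (L * T) ≤ 1) (hxy : ‖y₀ - x₀‖ ≤ ρ) :
    ∀ t ∈ Set.Icc (-r) T, ‖y t - x t‖ ≤ 2 * ρ * Real.exp (L * T) := by
  -- A barrier with `B' = L * B`. The factor 2 leaves a gap `ρ` above the initial deviation.
  set B : ℝ → ℝ := fun s => 2 * ρ * Real.exp (L * s) with hB
  have hBmono : Monotone B := fun s t hst => by simp only [hB]; gcongr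
  have hneg : ∀ s ∈ Set.Icc (-r) 0, ‖y s - x s‖ ≤ ρ := by
    intro s hs
    have := norm_apply_le_norm_historyAt (r := r) (y - x) (t := 0) (s := s) (by simpa using hs)
    refine this.trans ?_
    rwa [show historyAt r (y - x) 0 = historyAt r y 0 - historyAt r x 0 from rfl, hx.1, hy.1]
  have hB0 : ∀ s, 0 ≤ s → 2 * ρ ≤ B s := fun s hs => by
    simp only [hB]
    exact le_mul_of_one_le_right (by positivity) (Real.one_le_exp (by positivity))
  have main : ∀ t ∈ Set.Icc 0 T, ‖y t - x t‖ < B t := by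
    -- At the first time `t₀` the barrier is reached, both histories have so far stayed in the ball
    -- of radius `M + 1`, where `f` is `L`-Lipschitz; comparison with `B - ρ` then contradicts
    -- contact with `B`.
    by_contra! hcon
    have hcl : IsCompact {t ∈ Set.Icc 0 T | B t ≤ ‖y t - x t‖} := by
      refine isCompact_Icc.of_isClosed_subset ?_ fun t ht => ht.1
      have hBc : Continuous B := by simp only [hB]; fun_prop
      exact isClosed_Icc.inter (isClosed_le hBc (by fun_prop))
    obtain ⟨t₀, ⟨ht₀, hbad⟩, hleast⟩ := hcl.exists_isLeast hcon
    have hgood : ∀ s ∈ Set.Ico 0 t₀, ‖y s - x s‖ < B s := fun s hs => by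
      by_contra! h
      exact absurd (hleast ⟨⟨hs.1, hs.2.le.trans ht₀.2⟩, h⟩) (not_le.2 hs.2)
    have hhist : ∀ t ∈ Set.Ico 0 t₀, ‖historyAt r y t - historyAt r x t‖ ≤ B t := by
      intro t ht
      refine norm_historyAt_le (x := y - x) (by simp only [hB]; positivity) fun s hs => ?_
      rcases le_total s 0 with h | h
      · exact (hneg s ⟨by linarith [hs.1, ht.1], h⟩).trans (by linarith [hB0 t ht.1])
      · exact (hgood s ⟨h, hs.2.trans_lt ht.2⟩).le.trans (hBmono hs.2)
    have hder : ∀ t ∈ Set.Ico 0 t₀, ‖f (historyAt r y t) - f (historyAt r x t)‖ ≤ L * B t := by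
      intro t ht
      have hxt : ‖historyAt r x t‖ ≤ M := norm_historyAt_le M.coe_nonneg fun s hs =>
        hM s ⟨by linarith [hs.1, ht.1], by linarith [hs.2, ht.2, ht₀.2]⟩
      have hBt : B t ≤ 1 := (hBmono (by linarith [ht.2, ht₀.2])).trans hρ1
      have hyt : ‖historyAt r y t‖ ≤ M + 1 := by
        calc ‖historyAt r y t‖ = ‖historyAt r x t + (historyAt r y t - historyAt r x t)‖ := by
              rw [add_sub_cancel]
          _ ≤ M + 1 := (norm_add_le _ _).trans (add_le_add hxt ((hhist t ht).trans hBt))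
      exact (hL _ _ hyt (by linarith)).trans (by gcongr; exact hhist t ht)
    have hfin := image_norm_le_of_norm_deriv_right_le_deriv_boundary (a := 0) (b := t₀)
      (f := fun s => y s - x s) (f' := fun t => f (historyAt r y t) - f (historyAt r x t))
      (B := fun s => B s - ρ) (B' := fun s => L * B s) (by fun_prop)
      (fun t ht => ((hy.2 t ht.1).sub (hx.2 t ht.1)).mono (Set.Ici_subset_Ici.2 ht.1))
      ((hneg 0 ⟨by linarith, le_rfl⟩).trans (by linarith [hB0 0 le_rfl]))
      (fun s => by
        have h1 : HasDerivAt (fun s : ℝ => (L : ℝ) * s) L s := by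
          simpa using (hasDerivAt_id s).const_mul (L : ℝ)
        convert! (h1.exp.const_mul (2 * ρ)).sub_const ρ using 1
        simp only [hB]; ring)
      hder (Set.right_mem_Icc.2 ht₀.1)
    linarith [show ‖y t₀ - x t₀‖ ≤ B t₀ - ρ from hfin]
  intro t ht
  rcases le_total t 0 with h | h
  · exact (hneg t ⟨ht.1, h⟩).trans (by linarith [hB0 T hT])
  · exact (main t ⟨h, ht.2⟩).le.trans (hBmono ht.2)

theorem IsSolution.exists_continuous_dependence (hr : 0 ≤ r) {f : History n r → Vec n}
    (hf : LipschitzOnBounded f) {x₀ : History n r} {x : C(ℝ, Vec n)} (hx : IsSolution f x₀ x)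
    {T η : ℝ} (hT : 0 ≤ T) (hη : 0 < η) :
    ∃ ρ > 0, ∀ (y₀ : History n r) (y : C(ℝ, Vec n)), IsSolution f y₀ y → ‖y₀ - x₀‖ ≤ ρ →
      ∀ t ∈ Set.Icc (-r) T, ‖y t - x t‖ ≤ η := by
  obtain ⟨M, hM⟩ := exists_norm_le_on_Icc x (-r) T
  obtain ⟨L, hL⟩ := hf.exists_lipschitz_const (M + 1)
  have hE := Real.exp_pos (L * T)
  -- The barrier then ends at `min η 1`: `η` is the target, and `1` keeps `y` in the ball of radius
  -- `M + 1`.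
  have hρ : 0 < min η 1 / (2 * Real.exp (L * T)) := by positivity
  have heq : 2 * (min η 1 / (2 * Real.exp (L * T))) * Real.exp (L * T) = min η 1 := by
    field_simp
  refine ⟨_, hρ, fun y₀ y hy hxy t ht => ?_⟩
  have h := hx.norm_sub_le hr hy (by exact_mod_cast hL) hM hT hρ
    (by rw [heq]; exact min_le_right _ _) hxy t ht
  rw [heq] at h
  exact h.trans (min_le_left _ _)

theorem IsSolution.historyAt_eq (hr : 0 ≤ r) {f : History n r → Vec n}
    (hf : LipschitzOnBounded f) {x₀ : History n r} {x y : C(ℝ, Vec n)} (hx : IsSolution f x₀ x)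
    (hy : IsSolution f x₀ y) {t : ℝ} (ht : 0 ≤ t) : historyAt r x t = historyAt r y t := by
  have key : ∀ s ∈ Set.Icc (-r) t, y s = x s := by
    intro s hs
    rw [← sub_eq_zero, ← norm_le_zero_iff]
    refine le_of_forall_pos_le_add fun η hη => ?_
    obtain ⟨ρ, hρ, H⟩ := hx.exists_continuous_dependence hr hf ht hη
    simpa using H x₀ y hy (by simpa using hρ.le) s hs
  ext1 s
  exact (key _ ⟨by linarith [s.2.1], by linarith [s.2.2]⟩).symm

theorem norm_apply_le_of_lipschitz {f : History n r → Vec n} (hf0 : f 0 = 0) {M L : ℝ≥0}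
    (hL : ∀ u v : History n r, ‖u‖ ≤ M → ‖v‖ ≤ M → ‖f u - f v‖ ≤ L * ‖u - v‖)
    {u : History n r} (hu : ‖u‖ ≤ M) : ‖f u‖ ≤ L * M := by
  have h := hL u 0 hu (by simp)
  rw [hf0, sub_zero, sub_zero] at h
  exact h.trans (by gcongr)

/-- A solution bounded by `M` on `[a-r,b]`, `0 ≤ a`, is Lipschitz on `[a,b]`. -/
theorem IsSolution.lipschitzOnWith {f : History n r → Vec n} (hf0 : f 0 = 0)
    {x₀ : History n r} {x : C(ℝ, Vec n)} (hx : IsSolution f x₀ x) {M L : ℝ≥0}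
    (hL : ∀ u v : History n r, ‖u‖ ≤ M → ‖v‖ ≤ M → ‖f u - f v‖ ≤ L * ‖u - v‖)
    {a b : ℝ} (ha : 0 ≤ a) (hM : ∀ s ∈ Set.Icc (a - r) b, ‖x s‖ ≤ M) :
    LipschitzOnWith (L * M) x (Set.Icc a b) := by
  refine (convex_Icc a b).lipschitzOnWith_of_nnnorm_hasDerivWithin_le
    (f' := fun t => f (historyAt r x t))
    (fun t ht => (hx.2 t (ha.trans ht.1)).mono fun s hs => ha.trans hs.1) fun t ht => ?_
  rw [← NNReal.coe_le_coe]
  exact norm_apply_le_of_lipschitz hf0 hL (norm_historyAt_le M.coe_nonneg fun s hs =>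
    hM s ⟨by linarith [hs.1, ht.1], hs.2.trans ht.2⟩)

/-! ### State norms along solutions: smoothing and growth. -/

variable {a : ℝ} {N : History n r → ℝ≥0∞}

theorem IsStateNorm.enorm_le {hr : 0 ≤ r} (hN : IsStateNorm hr a N) (x : History n r) :
    ‖x‖ₑ ≤ N x :=
  (le_max_left _ _).trans (hN.hoelder_le x)

theorem enorm_le_coe {x : History n r} {M : ℝ≥0} (h : ‖x‖ ≤ M) : ‖x‖ₑ ≤ M := by
  rw [enorm_eq_nnnorm, ENNReal.coe_le_coe]; exact h

/-- After one delay, the state norm is controlled by the supremum norm. -/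
theorem IsSolution.stateNorm_le {C : ℝ≥0} (hr : 0 ≤ r)
    (hC : ∀ (D : ℝ≥0) (y : History n r), LipschitzWith D y → N y ≤ ‖y‖ₑ + C * D)
    {f : History n r → Vec n} (hf0 : f 0 = 0)
    {x₀ : History n r} {x : C(ℝ, Vec n)} (hx : IsSolution f x₀ x) {M L : ℝ≥0}
    (hL : ∀ u v : History n r, ‖u‖ ≤ M → ‖v‖ ≤ M → ‖f u - f v‖ ≤ L * ‖u - v‖)
    {t : ℝ} (ht : r ≤ t) (hM : ∀ s ∈ Set.Icc (t - 2 * r) t, ‖x s‖ ≤ M) :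
    N (historyAt r x t) ≤ (M + C * (L * M) : ℝ≥0) := by
  have h1 := hx.lipschitzOnWith hf0 hL (a := t - r) (b := t) (by linarith) fun s hs =>
    hM s ⟨by linarith [hs.1], hs.2⟩
  have h2 : LipschitzWith (L * M) (historyAt r x t) := by
    refine LipschitzWith.of_dist_le_mul fun u v => ?_
    have h := h1.dist_le_mul (t + u) ⟨by linarith [u.2.1], by linarith [u.2.2]⟩ (t + v)
      ⟨by linarith [v.2.1], by linarith [v.2.2]⟩
    rwa [dist_add_left] at h
  refine (hC _ _ h2).trans ?_
  push_cast
  gcongr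
  exact enorm_le_coe (norm_historyAt_le M.coe_nonneg fun s hs => hM s ⟨by linarith [hs.1], hs.2⟩)

/-- The state norm stays bounded as long as the solution does. -/
theorem IsSolution.stateNorm_le_add {hr : 0 ≤ r} (hN : IsStateNorm hr a N) {C : ℝ≥0}
    (hC : ∀ (D : ℝ≥0) (y : History n r), LipschitzWith D y → N y ≤ ‖y‖ₑ + C * D)
    {f : History n r → Vec n} (hf0 : f 0 = 0)
    {x₀ : History n r} {x : C(ℝ, Vec n)} (hx : IsSolution f x₀ x) {M L : ℝ≥0}
    (hL : ∀ u v : History n r, ‖u‖ ≤ M → ‖v‖ ≤ M → ‖f u - f v‖ ≤ L * ‖u - v‖)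
    (t : ℝ≥0) (hM : ∀ s ∈ Set.Icc (-r) (t : ℝ), ‖x s‖ ≤ M) :
    N (historyAt r x t) ≤ N x₀ + (2 * M + C * (L * M) : ℝ≥0) := by
  have h1 := hx.lipschitzOnWith hf0 hL (a := 0) (b := t) le_rfl fun s hs =>
    hM s ⟨by linarith [hs.1], hs.2⟩
  -- The part of the segment still inherited from `x₀` need not be Lipschitz, so it is split off as
  -- `holdShift`; the remainder `v` only sees the solution on `[0, t]`.
  let v : History n r :=
    ⟨fun s => x (max ((t : ℝ) + s) 0) - x 0, by fun_prop⟩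
  have hmem : ∀ s : Set.Icc (-r) (0 : ℝ), max ((t : ℝ) + s) 0 ∈ Set.Icc (0 : ℝ) t := fun s =>
    ⟨le_max_right _ _, max_le (by linarith [s.2.2]) t.coe_nonneg⟩
  have hv : historyAt r x t = holdShift hr t x₀ + v := by
    ext1 s
    have hx₀ : holdShift hr t x₀ s = x (min ((t : ℝ) + s) 0) := by
      rw [← hx.1]
      exact congrArg x (zero_add _)
    rw [ContinuousMap.add_apply, hx₀]
    change x (t + s) = x (min ((t : ℝ) + s) 0) + (x (max ((t : ℝ) + s) 0) - x 0)
    rcases le_total ((t : ℝ) + s) 0 with h | h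
    · rw [min_eq_left h, max_eq_right h, sub_self, add_zero]
    · rw [min_eq_right h, max_eq_left h, add_sub_cancel]
  have hvl : LipschitzWith (L * M) v := by
    refine LipschitzWith.of_dist_le_mul fun u w => ?_
    change dist (x (max ((t : ℝ) + u) 0) - x 0) (x (max ((t : ℝ) + w) 0) - x 0) ≤ _
    rw [dist_sub_right]
    refine (h1.dist_le_mul _ (hmem u) _ (hmem w)).trans ?_
    gcongr
    rw [Subtype.dist_eq, Real.dist_eq, Real.dist_eq]
    refine (abs_max_sub_max_le_max _ _ _ _).trans_eq ?_
    rw [add_sub_add_left_eq_sub, sub_zero, abs_zero, max_eq_left (abs_nonneg _)]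
  have hvn : ‖v‖ ≤ (2 * M : ℝ≥0) := by
    refine (ContinuousMap.norm_le _ (NNReal.coe_nonneg _)).2 fun s => ?_
    refine (_root_.norm_sub_le _ _).trans ?_
    push_cast
    have h2 := hM _ ⟨by linarith [(hmem s).1], (hmem s).2⟩
    have h3 := hM 0 ⟨by linarith, t.coe_nonneg⟩
    linarith
  rw [hv]
  refine (hN.add_le _ _).trans (add_le_add (hN.holdShift_le t x₀) ((hC _ _ hvl).trans ?_))
  push_cast
  gcongr
  simpa using enorm_le_coe hvn

/-! ### Uniformity on Hölder balls -/

/-- Here `N x₀` may be infinite, as for a Hölder function outside the Sobolev space. By smoothing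
the state at time `r` has finite norm, so attractivity applies from there, and uniqueness identifies
the two solutions. -/
theorem IsSolution.exists_norm_le_of_globallyAttractive (hr : 0 < r) (hN : IsStateNorm hr.le a N)
    {f : History n r → Vec n} (hf0 : f 0 = 0) (hf : LipschitzOnBounded f)
    (hGA : GloballyAttractive N f) {x₀ : History n r} {x : C(ℝ, Vec n)} (hx : IsSolution f x₀ x)
    {η : ℝ≥0} (hη : 0 < η) : ∃ T : ℝ, 0 ≤ T ∧ ∀ s, T ≤ s → ‖x s‖ ≤ η := by
  obtain ⟨C, hC⟩ := hN.lipschitz_le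
  obtain ⟨M, hM⟩ := exists_norm_le_on_Icc x (-r) r
  obtain ⟨L, hL⟩ := hf.exists_lipschitz_const M
  have hfin : N (historyAt r x r) < ∞ :=
    (hx.stateNorm_le hr.le hC hf0 hL le_rfl fun s hs =>
      hM s ⟨by linarith [hs.1], hs.2⟩).trans_lt ENNReal.coe_lt_top
  obtain ⟨z, hz, hlim⟩ := hGA _ hfin
  have hev : ∀ᶠ t : ℝ≥0 in Filter.atTop, N (historyAt r z t) < η :=
    hlim.eventually_lt_const (by exact_mod_cast hη)
  obtain ⟨T, hT⟩ := Filter.eventually_atTop.1 hev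
  refine ⟨r + T, by positivity, fun s hs => ?_⟩
  obtain ⟨q, hq⟩ : ∃ q : ℝ≥0, (q : ℝ) = s - r :=
    ⟨⟨s - r, by linarith [T.coe_nonneg]⟩, rfl⟩
  have h1 := hT q (by rw [← NNReal.coe_le_coe]; linarith)
  rw [← (hx.shift hr.le).historyAt_eq hr.le hf hz q.coe_nonneg, historyAt_shift, hq,
    add_sub_cancel] at h1
  have h2 := (hN.enorm_le _).trans h1.le
  rw [enorm_eq_nnnorm, ENNReal.coe_le_coe, ← NNReal.coe_le_coe, coe_nnnorm] at h2
  exact (norm_apply_le_norm_historyAt x ⟨by linarith, le_rfl⟩).trans h2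

theorem exists_uniform_attraction_time (hr : 0 < r) (ha : 0 < a) (hN : IsStateNorm hr.le a N)
    {f : History n r → Vec n} (hf0 : f 0 = 0) (hf : LipschitzOnBounded f)
    (hfc : ∀ x₀ : History n r, hoelderNorm a x₀ < ∞ → ∃ x : C(ℝ, Vec n), IsSolution f x₀ x)
    (hLS : LyapunovStable N f) (hGA : GloballyAttractive N f) (R : ℝ≥0) {ε : ℝ≥0} (hε : 0 < ε) :
    ∃ T : ℝ≥0, ∀ x₀, hoelderNorm a x₀ ≤ R → ∀ x, IsSolution f x₀ x →
      ∀ t : ℝ≥0, T ≤ t → N (historyAt r x t) ≤ ε := by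
  obtain ⟨C, hC⟩ := hN.lipschitz_le
  obtain ⟨δ, hδ, hstab⟩ := hLS ε hε
  obtain ⟨L, hL⟩ := hf.exists_lipschitz_const 1
  -- By the smoothing estimate, a trajectory below `η` over two delays has state norm at most `η + C
  -- * (L * η)`; `η ≤ 1` allows the Lipschitz constant of the unit ball.
  obtain ⟨η, hη, hη1, hηδ⟩ : ∃ η : ℝ≥0, 0 < η ∧ η ≤ 1 ∧ η + C * (L * η) ≤ δ := by
    refine ⟨min 1 (δ / (1 + C * L)), by positivity, min_le_left _ _, ?_⟩
    calc _ = min 1 (δ / (1 + C * L)) * (1 + C * L) := by ring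
      _ ≤ δ / (1 + C * L) * (1 + C * L) := by gcongr; exact min_le_right _ _
      _ = δ := div_mul_cancel₀ _ (by positivity)
  refine (isCompact_hoelder_ball ha R).induction_on
    (p := fun S => ∃ T : ℝ≥0, ∀ x₀ ∈ S, ∀ x, IsSolution f x₀ x →
      ∀ t : ℝ≥0, T ≤ t → N (historyAt r x t) ≤ ε) ⟨0, by simp⟩ ?_ ?_ ?_
  · rintro S S' hS ⟨T, hT⟩
    exact ⟨T, fun x₀ hx₀ => hT x₀ (hS hx₀)⟩
  · rintro S S' ⟨T, hT⟩ ⟨T', hT'⟩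
    refine ⟨max T T', fun x₀ hx₀ x hx t ht => ?_⟩
    rcases hx₀ with h | h
    · exact hT x₀ h x hx t ((le_max_left _ _).trans ht)
    · exact hT' x₀ h x hx t ((le_max_right _ _).trans ht)
  · intro x₀ hx₀
    obtain ⟨x, hx⟩ := hfc x₀ (lt_of_le_of_lt hx₀ ENNReal.coe_lt_top)
    obtain ⟨T₁, hT₁0, hT₁⟩ :=
      hx.exists_norm_le_of_globallyAttractive hr hN hf0 hf hGA (η := η / 2) (by positivity)
    -- One delay for the segment at time `T`, another for the histories that determine its
    -- derivative.
    set T : ℝ≥0 := ⟨T₁ + 2 * r, by positivity⟩ with hTdef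
    have hTr : (T : ℝ) = T₁ + 2 * r := rfl
    obtain ⟨ρ, hρ, hdep⟩ := hx.exists_continuous_dependence hr.le hf T.coe_nonneg
      (η := (η / 2 : ℝ≥0)) (by positivity)
    refine ⟨Metric.closedBall x₀ ρ, mem_nhdsWithin_of_mem_nhds (Metric.closedBall_mem_nhds _ hρ),
      T, fun y₀ hy₀ y hy t ht => ?_⟩
    have hsmall : ∀ s ∈ Set.Icc ((T : ℝ) - 2 * r) T, ‖y s‖ ≤ η := by
      intro s hs
      have h1 := hdep y₀ y hy (by rwa [← dist_eq_norm]) s ⟨by linarith [hs.1], hs.2⟩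
      have h2 := hT₁ s (by linarith [hs.1])
      calc ‖y s‖ = ‖(y s - x s) + x s‖ := by rw [sub_add_cancel]
        _ ≤ (η / 2 : ℝ≥0) + (η / 2 : ℝ≥0) := (norm_add_le _ _).trans (add_le_add h1 h2)
        _ = η := by push_cast; ring
    have hNT : N (historyAt r y T) ≤ δ :=
      (hy.stateNorm_le hr.le hC hf0 (M := η) (L := L)
        (fun u v hu hv => hL u v (hu.trans (by exact_mod_cast hη1))
          (hv.trans (by exact_mod_cast hη1))) (by linarith) hsmall).trans
        (by exact_mod_cast hηδ)
    obtain ⟨z, hz, hzε⟩ := hstab _ hNT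
    have h3 := hzε (t - T)
    rw [← (hy.shift T.coe_nonneg).historyAt_eq hr.le hf hz (t - T).coe_nonneg, historyAt_shift,
      NNReal.coe_sub ht, add_sub_cancel] at h3
    exact h3

theorem exists_uniform_bound_on_Icc (hr : 0 < r) (ha : 0 < a)
    {f : History n r → Vec n} (hf : LipschitzOnBounded f)
    (hfc : ∀ x₀ : History n r, hoelderNorm a x₀ < ∞ → ∃ x : C(ℝ, Vec n), IsSolution f x₀ x)
    (R T : ℝ≥0) :
    ∃ M : ℝ≥0, ∀ x₀, hoelderNorm a x₀ ≤ R → ∀ x, IsSolution f x₀ x →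
      ∀ t ∈ Set.Icc (-r) (T : ℝ), ‖x t‖ ≤ M := by
  refine (isCompact_hoelder_ball ha R).induction_on
    (p := fun S => ∃ M : ℝ≥0, ∀ x₀ ∈ S, ∀ x, IsSolution f x₀ x →
      ∀ t ∈ Set.Icc (-r) (T : ℝ), ‖x t‖ ≤ M) ⟨0, by simp⟩ ?_ ?_ ?_
  · rintro S S' hS ⟨T, hT⟩
    exact ⟨T, fun x₀ hx₀ => hT x₀ (hS hx₀)⟩
  · rintro S S' ⟨M, hM⟩ ⟨M', hM'⟩
    refine ⟨max M M', fun x₀ hx₀ x hx t ht => ?_⟩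
    rcases hx₀ with h | h
    · exact (hM x₀ h x hx t ht).trans (by exact_mod_cast le_max_left _ _)
    · exact (hM' x₀ h x hx t ht).trans (by exact_mod_cast le_max_right _ _)
  · intro x₀ hx₀
    obtain ⟨x, hx⟩ := hfc x₀ (lt_of_le_of_lt hx₀ ENNReal.coe_lt_top)
    obtain ⟨M, hM⟩ := exists_norm_le_on_Icc x (-r) T
    obtain ⟨ρ, hρ, hdep⟩ := hx.exists_continuous_dependence hr.le hf T.coe_nonneg one_pos
    refine ⟨Metric.closedBall x₀ ρ, mem_nhdsWithin_of_mem_nhds (Metric.closedBall_mem_nhds _ hρ),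
      1 + M, fun y₀ hy₀ y hy t ht => ?_⟩
    have h1 := hdep y₀ y hy (by rwa [← dist_eq_norm]) t ht
    calc ‖y t‖ = ‖(y t - x t) + x t‖ := by rw [sub_add_cancel]
      _ ≤ 1 + M := (norm_add_le _ _).trans (add_le_add h1 (hM t ht))

/-- Beyond the uniform attraction time for `ε = 1` the bound is `1`; before it, the uniform supremum
bound feeds `IsSolution.stateNorm_le_add`. -/
theorem exists_uniform_stateNorm_bound (hr : 0 < r) (ha : 0 < a) (hN : IsStateNorm hr.le a N)
    {f : History n r → Vec n} (hf0 : f 0 = 0) (hf : LipschitzOnBounded f)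
    (hfc : ∀ x₀ : History n r, hoelderNorm a x₀ < ∞ → ∃ x : C(ℝ, Vec n), IsSolution f x₀ x)
    (hLS : LyapunovStable N f) (hGA : GloballyAttractive N f) (R : ℝ≥0) :
    ∃ B : ℝ≥0, ∀ x₀, N x₀ ≤ R → ∀ x, IsSolution f x₀ x →
      ∀ t : ℝ≥0, N (historyAt r x t) ≤ B := by
  obtain ⟨C, hC⟩ := hN.lipschitz_le
  obtain ⟨T, hT⟩ := exists_uniform_attraction_time hr ha hN hf0 hf hfc hLS hGA R one_pos
  obtain ⟨M, hM⟩ := exists_uniform_bound_on_Icc hr ha hf hfc R T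
  obtain ⟨L, hL⟩ := hf.exists_lipschitz_const M
  refine ⟨max 1 (R + (2 * M + C * (L * M))), fun x₀ hx₀ x hx t => ?_⟩
  have hx₀' := (hN.hoelder_le x₀).trans hx₀
  rcases le_total T t with h | h
  · exact (hT x₀ hx₀' x hx t h).trans (by exact_mod_cast le_max_left _ _)
  · refine (hx.stateNorm_le_add hN hC hf0 hL t fun s hs =>
      hM x₀ hx₀' x hx s ⟨hs.1, hs.2.trans (by exact_mod_cast h)⟩).trans ?_
    refine (add_le_add hx₀ le_rfl).trans ?_
    rw [← ENNReal.coe_add, ENNReal.coe_le_coe]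
    exact le_max_right _ _

/-! ### Comparison functions -/

/-- A function of two nonnegative arguments that is monotone in the first, decays to zero in the
second, and vanishes at the origin of the first is dominated by a function of class `KL`. -/
theorem exists_classKL_ge {ω : ℝ≥0 → ℝ≥0 → ℝ≥0} (hmono : ∀ t, Monotone fun s => ω s t)
    (hanti : ∀ s, Antitone (ω s)) (hlim : ∀ s, Filter.Tendsto (ω s) Filter.atTop (𝓝 0))
    (hzero : Filter.Tendsto (fun s => ω s 0) (𝓝 0) (𝓝 0)) :
    ∃ σ, ClassKL σ ∧ ∀ s t, ω s t ≤ σ s t := by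
  have hzero' : ∀ t, Filter.Tendsto (fun s => ω s t) (𝓝 0) (𝓝 0) := fun t =>
    tendsto_of_tendsto_of_tendsto_of_le_of_le tendsto_const_nhds hzero (fun _ => zero_le)
      fun s => hanti s zero_le
  set w : ℝ≥0 → ℝ → ℝ := fun t u => ω u.toNNReal t with hw
  have hwmono : ∀ t, Monotone (w t) := fun t u v huv =>
    NNReal.coe_le_coe.2 (hmono t (Real.toNNReal_mono huv))
  have hint : ∀ (t s : ℝ≥0) (b c : ℝ), IntervalIntegrable (fun v => w t (s * v)) volume b c :=
    fun t s b c => Monotone.intervalIntegrable fun u v huv =>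
      hwmono t (mul_le_mul_of_nonneg_left huv s.coe_nonneg)
  -- The average of `ω(·, t)` over `[s, 2s]` lies between `ω s t` and `ω (2 * s) t` and, unlike `ω`,
  -- is continuous in `s`: for `s ≠ 0` it is a difference of values of a primitive divided by `s`,
  -- at `0` it is squeezed.
  set I : ℝ≥0 → ℝ≥0 → ℝ := fun s t => ∫ v in (1 : ℝ)..2, w t (s * v) with hI
  have hIle : ∀ s t, I s t ≤ ω (2 * s) t := by
    intro s t
    have h : I s t ≤ ∫ _ in (1 : ℝ)..2, w t (s * 2) :=
      intervalIntegral.integral_mono_on (by norm_num) (hint t s 1 2) (by simp) fun v hv =>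
        hwmono t (mul_le_mul_of_nonneg_left hv.2 s.coe_nonneg)
    have h2 : w t (s * 2) = ω (2 * s) t := by
      simp only [hw]
      rw [mul_comm, show (2 * s : ℝ) = ((2 * s : ℝ≥0) : ℝ) by push_cast; rfl, Real.toNNReal_coe]
    rw [intervalIntegral.integral_const, h2] at h
    norm_num at h
    exact h
  have hIge : ∀ s t, (ω s t : ℝ) ≤ I s t := by
    intro s t
    have h : ∫ _ in (1 : ℝ)..2, w t s ≤ I s t :=
      intervalIntegral.integral_mono_on (by norm_num) (by simp) (hint t s 1 2) fun v hv =>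
        hwmono t (le_mul_of_one_le_right s.coe_nonneg hv.1)
    have h2 : w t s = ω s t := by simp only [hw, Real.toNNReal_coe]
    rw [intervalIntegral.integral_const, h2] at h
    norm_num at h
    exact h
  have hI0 : ∀ s t, 0 ≤ I s t := fun s t => (NNReal.coe_nonneg _).trans (hIge s t)
  have hImono : ∀ t, Monotone fun s => I s t := fun t s s' hs =>
    intervalIntegral.integral_mono_on (by norm_num) (hint t s 1 2) (hint t s' 1 2) fun v hv =>
      hwmono t (mul_le_mul_of_nonneg_right (by exact_mod_cast hs) (by linarith [hv.1]))
  have hIanti : ∀ s, Antitone (I s) := fun s t t' ht =>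
    intervalIntegral.integral_mono_on (by norm_num) (hint t' s 1 2) (hint t s 1 2) fun v _ =>
      NNReal.coe_le_coe.2 (hanti _ ht)
  have hIzero : ∀ t, I 0 t = 0 := by
    intro t
    have h := hIle 0 t
    rw [mul_zero] at h
    have h0 : ω 0 t = 0 := tendsto_nhds_unique (tendsto_pure_nhds (fun s => ω s t) 0)
      ((hzero' t).mono_left (pure_le_nhds 0))
    rw [h0] at h
    exact le_antisymm h (hI0 0 t)
  have hIcont : ∀ t, Continuous fun s => I s t := by
    intro t
    refine continuous_iff_continuousAt.2 fun s => ?_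
    rcases eq_or_ne s 0 with rfl | hs
    · rw [ContinuousAt, hIzero]
      refine squeeze_zero (fun s => hI0 s t) (fun s => hIle s t) ?_
      have h2 : Filter.Tendsto (fun s : ℝ≥0 => 2 * s) (𝓝 0) (𝓝 0) := by
        have : Continuous fun s : ℝ≥0 => 2 * s := by fun_prop
        simpa using this.tendsto 0
      exact_mod_cast (NNReal.continuous_coe.tendsto 0).comp ((hzero' t).comp h2)
    · have hF : Continuous fun b : ℝ => ∫ u in (0 : ℝ)..b, w t u :=
        intervalIntegral.continuous_primitive (fun b c => (hwmono t).intervalIntegrable) 0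
      have heq : (fun s : ℝ≥0 => (s : ℝ)⁻¹ *
          ((∫ u in (0 : ℝ)..(s * 2 : ℝ), w t u) - ∫ u in (0 : ℝ)..(s * 1 : ℝ), w t u)) =ᶠ[𝓝 s]
          fun s => I s t := by
        filter_upwards [isOpen_ne.mem_nhds hs] with u hu
        have hu' : (u : ℝ) ≠ 0 := by exact_mod_cast hu
        rw [intervalIntegral.integral_interval_sub_left (hwmono t).intervalIntegrable
          (hwmono t).intervalIntegrable]
        simp only [hI]
        rw [intervalIntegral.integral_comp_mul_left _ hu', smul_eq_mul]
      refine ContinuousAt.congr ?_ heq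
      refine ContinuousAt.mul ?_ ?_
      · exact NNReal.continuous_coe.continuousAt.inv₀ (by exact_mod_cast hs)
      · exact ((hF.comp (by fun_prop)).sub (hF.comp (by fun_prop))).continuousAt
  -- The term `s / (1 + t)` supplies strict monotonicity in `s` and still decays in `t`.
  refine ⟨fun s t => (I s t).toNNReal + s / (1 + t), ⟨fun t => ⟨?_, ?_, ?_⟩, fun s => ⟨?_, ?_⟩⟩, ?_⟩
  · intro s s' hs
    exact add_lt_add_of_le_of_lt (Real.toNNReal_mono (hImono t hs.le))
      (div_lt_div_of_pos_right hs (by positivity))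
  · exact (continuous_real_toNNReal.comp (hIcont t)).add (continuous_id.div_const _)
  · simp [hIzero]
  · intro t t' ht
    exact add_le_add (Real.toNNReal_mono (hIanti s ht)) (by gcongr)
  · rw [← add_zero (0 : ℝ≥0)]
    refine Filter.Tendsto.add ?_ ?_
    · refine tendsto_of_tendsto_of_tendsto_of_le_of_le tendsto_const_nhds (hlim (2 * s))
        (fun _ => zero_le) fun t => ?_
      exact Real.toNNReal_le_iff_le_coe.2 (hIle s t)
    · have h : Filter.Tendsto (fun t : ℝ≥0 => 1 + (t : ℝ)) Filter.atTop Filter.atTop :=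
        Filter.tendsto_atTop_add_const_left _ _ (NNReal.tendsto_coe_atTop.2 Filter.tendsto_id)
      rw [← NNReal.tendsto_coe]
      simpa using h.const_div_atTop (s : ℝ)
  · intro s t
    exact (NNReal.le_toNNReal_of_coe_le (hIge s t)).trans le_self_add

/-! ### Equivalence -/

theorem toNNReal_le_of_le_coe {b : ℝ≥0∞} {c : ℝ≥0} (h : b ≤ c) : b.toNNReal ≤ c :=
  ENNReal.toNNReal_mono ENNReal.coe_ne_top h

theorem UGAS.gas {N : History n r → ℝ≥0∞} {f : History n r → Vec n} (h : UGAS N f) : GAS N f := by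
  obtain ⟨σ, hσ, H⟩ := h
  constructor
  · intro ε hε
    obtain ⟨hmono, hcont, h0⟩ := hσ.1 0
    have hev : ∀ᶠ s in 𝓝 (0 : ℝ≥0), σ s 0 < ε :=
      (hcont.tendsto 0).eventually_lt_const (by simpa [h0] using hε)
    obtain ⟨δ, hδ, hball⟩ := NNReal.nhds_zero_basis.eventually_iff.1 hev
    refine ⟨δ / 2, by positivity, fun x₀ hx₀ => ?_⟩
    obtain ⟨x, hx, hb⟩ := H x₀ (hx₀.trans_lt ENNReal.coe_lt_top)
    refine ⟨x, hx, fun t => (hb t).trans (ENNReal.coe_le_coe.2 ?_)⟩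
    have h1 : (N x₀).toNNReal < δ :=
      (toNNReal_le_of_le_coe hx₀).trans_lt (NNReal.half_lt_self hδ.ne')
    exact ((hσ.2 _).1 zero_le).trans (hball h1).le
  · intro x₀ hx₀
    obtain ⟨x, hx, hb⟩ := H x₀ hx₀
    refine ⟨x, hx, tendsto_of_tendsto_of_tendsto_of_le_of_le tendsto_const_nhds ?_
      (fun _ => zero_le) hb⟩
    simpa using ENNReal.tendsto_coe.2 (hσ.2 (N x₀).toNNReal).2

theorem GAS.ugas (hr : 0 < r) (ha : 0 < a) (hN : IsStateNorm hr.le a N)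
    {f : History n r → Vec n} (hf0 : f 0 = 0) (hf : LipschitzOnBounded f)
    (hfc : ∀ x₀ : History n r, hoelderNorm a x₀ < ∞ → ∃ x : C(ℝ, Vec n), IsSolution f x₀ x)
    (h : GAS N f) : UGAS N f := by
  obtain ⟨hLS, hGA⟩ := h
  -- Taking the supremum over all `τ ≥ t` makes `Ω` antitone in `t` by construction. Uniform
  -- boundedness makes it finite, uniform attraction gives decay in `t`, and Lyapunov stability
  -- gives the limit as `s → 0`.
  set Ω : ℝ≥0 → ℝ≥0 → ℝ≥0∞ := fun s t => ⨆ (x₀ : History n r) (x : C(ℝ, Vec n)) (τ : ℝ≥0)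
    (_ : N x₀ ≤ s ∧ IsSolution f x₀ x ∧ t ≤ τ), N (historyAt r x τ) with hΩ
  have hΩle : ∀ {s t : ℝ≥0} {B : ℝ≥0∞}, (∀ x₀, N x₀ ≤ s → ∀ x, IsSolution f x₀ x →
      ∀ τ : ℝ≥0, t ≤ τ → N (historyAt r x τ) ≤ B) → Ω s t ≤ B := fun hB =>
    iSup_le fun x₀ => iSup_le fun x => iSup_le fun τ => iSup_le fun hτ =>
      hB x₀ hτ.1 x hτ.2.1 τ hτ.2.2
  have hleΩ : ∀ {s t : ℝ≥0} {x₀ x} {τ : ℝ≥0}, N x₀ ≤ s → IsSolution f x₀ x → t ≤ τ →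
      N (historyAt r x τ) ≤ Ω s t := fun {s t x₀ x τ} h1 h2 h3 =>
    le_iSup_of_le x₀ (le_iSup_of_le x (le_iSup_of_le τ (le_iSup_of_le ⟨h1, h2, h3⟩ le_rfl)))
  have hfin : ∀ s t, Ω s t ≠ ∞ := fun s t => by
    obtain ⟨B, hB⟩ := exists_uniform_stateNorm_bound hr ha hN hf0 hf hfc hLS hGA s
    exact ((hΩle fun x₀ hx₀ x hx τ _ => hB x₀ hx₀ x hx τ).trans_lt ENNReal.coe_lt_top).ne
  obtain ⟨σ, hσ, hle⟩ := exists_classKL_ge (ω := fun s t => (Ω s t).toNNReal)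
    (fun t s s' hs => ENNReal.toNNReal_mono (hfin _ _) (hΩle fun x₀ hx₀ x hx τ hτ =>
      hleΩ (hx₀.trans (by exact_mod_cast hs)) hx hτ))
    (fun s t t' ht => ENNReal.toNNReal_mono (hfin _ _) (hΩle fun x₀ hx₀ x hx τ hτ =>
      hleΩ hx₀ hx (ht.trans hτ)))
    (fun s => by
      refine (nhds_bot_basis_Iic (α := ℝ≥0)).tendsto_right_iff.2 fun ε hε => ?_
      obtain ⟨T, hT⟩ := exists_uniform_attraction_time hr ha hN hf0 hf hfc hLS hGA s hε
      filter_upwards [Filter.eventually_ge_atTop T] with t ht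
      exact toNNReal_le_of_le_coe (hΩle fun x₀ hx₀ x hx τ hτ =>
        hT x₀ ((hN.hoelder_le x₀).trans hx₀) x hx τ (ht.trans hτ)))
    (by
      refine (nhds_bot_basis_Iic (α := ℝ≥0)).tendsto_right_iff.2 fun ε hε => ?_
      obtain ⟨δ, hδ, hstab⟩ := hLS ε hε
      filter_upwards [Iic_mem_nhds hδ] with s hs
      refine toNNReal_le_of_le_coe (hΩle fun x₀ hx₀ x hx τ _ => ?_)
      obtain ⟨z, hz, hzε⟩ := hstab x₀ (hx₀.trans (by exact_mod_cast hs))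
      exact hx.historyAt_eq hr.le hf hz τ.coe_nonneg ▸ hzε τ)
  refine ⟨σ, hσ, fun x₀ hx₀ => ?_⟩
  obtain ⟨x, hx⟩ := hfc x₀ ((hN.hoelder_le x₀).trans_lt hx₀)
  refine ⟨x, hx, fun t => ?_⟩
  have h1 : N x₀ ≤ ((N x₀).toNNReal : ℝ≥0∞) := (ENNReal.coe_toNNReal hx₀.ne).ge
  refine (hleΩ h1 hx le_rfl).trans ?_
  rw [← ENNReal.coe_toNNReal (hfin _ _)]
  exact ENNReal.coe_le_coe.2 (hle _ _)

end DelaySystem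

theorem theorem3 (n : ℕ) (r : ℝ) (hr : 0 < r)
    (f : DelaySystem.History n r → DelaySystem.Vec n) (hf0 : f 0 = 0)
    (hf : DelaySystem.LipschitzOnBounded f) (p : ℝ≥0∞) (hp : 1 < p)
    (hfc : ∀ x₀ : DelaySystem.History n r,
      DelaySystem.hoelderNorm (1 - p⁻¹).toReal x₀ < ∞ →
        ∃ x : C(ℝ, DelaySystem.Vec n), DelaySystem.IsSolution f x₀ x) :
    (DelaySystem.GAS (DelaySystem.sobolevNorm hr p) f ↔
        DelaySystem.UGAS (DelaySystem.sobolevNorm hr p) f) ∧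
      (DelaySystem.GAS (DelaySystem.hoelderNorm (1 - p⁻¹).toReal) f ↔
        DelaySystem.UGAS (DelaySystem.hoelderNorm (1 - p⁻¹).toReal) f) := by
  have hpos : 0 < (1 - p⁻¹).toReal := by
    refine ENNReal.toReal_pos (tsub_pos_of_lt ?_).ne' (by simp)
    exact ENNReal.inv_lt_one.2 hp
  have hle : (1 - p⁻¹).toReal ≤ 1 := by
    simpa using ENNReal.toReal_mono ENNReal.one_ne_top (tsub_le_self (a := (1 : ℝ≥0∞)) (b := p⁻¹))
  exact ⟨⟨DelaySystem.GAS.ugas hr hpos (DelaySystem.isStateNorm_sobolevNorm hr hp.le) hf0 hf hfc,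
    DelaySystem.UGAS.gas⟩, ⟨DelaySystem.GAS.ugas hr hpos
      (DelaySystem.isStateNorm_hoelderNorm hr.le hpos hle) hf0 hf hfc, DelaySystem.UGAS.gas⟩⟩
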